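/- Let $\mathbb D=\{z=x+iy\in\mathbb C:|z|<1\}$ and let $$\widetilde\Delta=\frac{1-x^2-y^2}{4}\left(\frac{\partial^2}{\partial x^2}+\frac{\partial^2}{\partial y^2}\right).$$ For integers $p,q\ge 1$ let $\varphi^{(p,q)}$ be the scattering polynomial $$\varphi^{(p,q)}(\zeta)=\frac{(-1)^p}{q\,(p+q-1)!}\,(1-\zeta\bar\zeta)\,\frac{\partial^{p+q}}{\partial\zeta^p\,\partial\bar\zeta^q}(1-\zeta\bar\zeta)^{p+q-1}.$$ For $c\in\mathbb C$ let $\ker(\widetilde\Delta+c)$ be the complex vector space of continuous functions $u:\overline{\mathbb D}\to\mathbb C$ that vanish on the circle $|z|=1$ (Dirichlet boundary conditions) and satisfy $\widetilde\Delta u+cu=0$ on $\mathbb D$ in the sense of distributions; $c$ is an eigenvalue of $-\widetilde\Delta$ if this space is nonzero. Then: 1. every nonzero eigenvalue $c\in\mathbb C$ of $-\widetilde\Delta$ is a positive integer; 2. for all integers $p,q\ge1$ the equation $-\widetilde\Delta\varphi^{(p,q)}=pq\,\varphi^{(p,q)}$ holds pointwise; 3. for each positive integer $k$, $$\ker(\widetilde\Delta+k)=\operatorname{span}_{\mathbb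 C}\{\varphi^{(p,q)}|_{\overline{\mathbb D}} : p,q\ge 1,\ pq=k\},$$ and the dimension of $\ker(\widetilde\Delta+k)$ over $\mathbb C$ is the number of positive divisors of $k$. -/

import Mathlib

open MeasureTheory Metric
open scoped Laplacian Distributions ContDiff ComplexConjugate

noncomputable section

namespace ScatteringDisk

/-- The open unit disk `𝔻`. -/
def disk : TopologicalSpace.Opens ℂ := ⟨ball 0 1, isOpen_ball⟩

/-- The closed unit disk. -/
abbrev closedDisk : Set ℂ := closedBall 0 1

/-- The weight `(1 - x² - y²) / 4` at `z = x + iy`. -/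
def weight (z : ℂ) : ℂ := (((1 - ‖z‖ ^ 2) / 4 : ℝ) : ℂ)

/-- The hybrid laplacian `((1 - x² - y²) / 4) Δ`, acting on functions. -/
def hybridLaplacian (f : ℂ → ℂ) (z : ℂ) : ℂ := weight z * (Δ f) z

/-- The formal transpose `ψ ↦ Δ (((1 - x² - y²) / 4) ψ)` of the hybrid laplacian with respect to
Lebesgue measure, through which the hybrid laplacian acts on distributions. -/
def hybridLaplacianTranspose (ψ : ℂ → ℂ) : ℂ → ℂ := Δ (fun z => weight z * ψ z)

/-- The Wirtinger derivative `∂/∂ζ = (∂/∂x - i ∂/∂y) / 2`. -/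
def dZ (f : ℂ → ℂ) (ζ : ℂ) : ℂ :=
  (fderiv ℝ f ζ 1 - Complex.I * fderiv ℝ f ζ Complex.I) / 2

/-- The Wirtinger derivative `∂/∂ζ̄ = (∂/∂x + i ∂/∂y) / 2`. -/
def dZbar (f : ℂ → ℂ) (ζ : ℂ) : ℂ :=
  (fderiv ℝ f ζ 1 + Complex.I * fderiv ℝ f ζ Complex.I) / 2

/-- The scattering polynomial `φ^{(p,q)}`, for nonnegative indices. -/
def scatteringPoly (p q : ℕ) : ℂ → ℂ :=
  if 1 ≤ p ∧ 1 ≤ q then fun ζ =>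
    ((-1) ^ p / (q * (p + q - 1).factorial : ℂ)) * (1 - ζ * conj ζ) *
      (dZ^[p] (dZbar^[q] fun ξ => (1 - ξ * conj ξ) ^ (p + q - 1))) ζ
  else if q = 0 then fun ζ => conj ζ ^ p
  else 0

theorem contDiff_dZ {f : ℂ → ℂ} (hf : ContDiff ℝ ∞ f) : ContDiff ℝ ∞ (dZ f) := by
  have h : ContDiff ℝ ∞ (fderiv ℝ f) := hf.fderiv_right (by simp)
  unfold dZ
  fun_prop

theorem contDiff_dZbar {f : ℂ → ℂ} (hf : ContDiff ℝ ∞ f) : ContDiff ℝ ∞ (dZbar f) := by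
  have h : ContDiff ℝ ∞ (fderiv ℝ f) := hf.fderiv_right (by simp)
  unfold dZbar
  fun_prop

theorem contDiff_conj : ContDiff ℝ ∞ (fun ζ : ℂ => conj ζ) :=
  Complex.conjCLE.contDiff

theorem contDiff_scatteringPoly (p q : ℕ) : ContDiff ℝ ∞ (scatteringPoly p q) := by
  have hc := contDiff_conj
  have key : ContDiff ℝ ∞ (dZ^[p] (dZbar^[q] fun ξ => (1 - ξ * conj ξ) ^ (p + q - 1))) := by
    have h0 : ContDiff ℝ ∞ (fun ξ : ℂ => (1 - ξ * conj ξ) ^ (p + q - 1)) := by fun_prop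
    have h1 : ∀ n, ContDiff ℝ ∞ (dZbar^[n] fun ξ : ℂ => (1 - ξ * conj ξ) ^ (p + q - 1)) := by
      intro n
      induction n with
      | zero => exact h0
      | succ n ih => rw [Function.iterate_succ_apply']; exact contDiff_dZbar ih
    have h2 : ∀ n, ContDiff ℝ ∞
        (dZ^[n] (dZbar^[q] fun ξ : ℂ => (1 - ξ * conj ξ) ^ (p + q - 1))) := by
      intro n
      induction n with
      | zero => exact h1 q
      | succ n ih => rw [Function.iterate_succ_apply']; exact contDiff_dZ ih
    exact h2 p
  unfold scatteringPoly
  split_ifs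
  · fun_prop
  · fun_prop
  · exact contDiff_const

/-- The restriction of `φ^{(p,q)}` to the closed unit disk. -/
def scatteringMap (p q : ℕ) : C(closedDisk, ℂ) where
  toFun z := scatteringPoly p q z
  continuous_toFun := (contDiff_scatteringPoly p q).continuous.comp continuous_subtype_val

theorem contDiff_weight : ContDiff ℝ ∞ weight := by
  have h : ContDiff ℝ ∞ (fun z : ℂ => ‖z‖ ^ 2) := contDiff_norm_sq ℝ
  unfold weight
  exact Complex.ofRealCLM.contDiff.comp ((contDiff_const.sub h).div_const 4)

theorem continuous_hybridLaplacianTranspose {ψ : ℂ → ℂ} (hψ : ContDiff ℝ ∞ ψ) :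
    Continuous (hybridLaplacianTranspose ψ) := by
  have h : ContDiff ℝ ∞ (fun z => weight z * ψ z) := contDiff_weight.mul hψ
  have h2 : Continuous (iteratedFDeriv ℝ 2 (fun z => weight z * ψ z)) :=
    h.continuous_iteratedFDeriv (by norm_cast)
  unfold hybridLaplacianTranspose
  rw [InnerProductSpace.laplacian_eq_iteratedFDeriv_complexPlane]
  fun_prop

/-- Lebesgue measure on the closed disk. -/
def area : Measure closedDisk := (volume : Measure ℂ).comap (fun z : closedDisk => (z : ℂ))

theorem area_univ_lt_top : area Set.univ < ⊤ := by
  have h : area Set.univ = volume ((fun z : closedDisk => (z : ℂ)) '' Set.univ) :=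
    (MeasurableEmbedding.subtype_coe measurableSet_closedBall).comap_apply volume Set.univ
  rw [h, Set.image_univ, Subtype.range_coe]
  exact measure_closedBall_lt_top

theorem integrable_pairing (u : C(closedDisk, ℂ)) {g : ℂ → ℂ} (hg : Continuous g) :
    Integrable (fun z : closedDisk => u z * g z) area := by
  have hc : Continuous (fun z : closedDisk => u z * g z) := by fun_prop
  have : IsFiniteMeasure area := ⟨area_univ_lt_top⟩
  exact hc.integrable_of_hasCompactSupport (HasCompactSupport.of_compactSpace _)

/-- `ker (Δ̃ + c)` under Dirichlet boundary conditions: the continuous functions `u` on the closed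
disk that vanish on the unit circle and satisfy `Δ̃ u + c u = 0` in the sense of distributions on
the open disk. -/
def dirichletKer (c : ℂ) : Submodule ℂ C(closedDisk, ℂ) where
  carrier := {u | (∀ z : closedDisk, ‖(z : ℂ)‖ = 1 → u z = 0) ∧
    ∀ ψ : 𝓓(disk, ℂ), ∫ z : closedDisk, u z * (hybridLaplacianTranspose ψ z + c * ψ z) ∂area = 0}
  zero_mem' := by simp
  add_mem' := by
    rintro u v ⟨hu, hu'⟩ ⟨hv, hv'⟩
    refine ⟨fun z hz => by simp [hu z hz, hv z hz], fun ψ => ?_⟩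
    have hψ : Continuous (fun z => hybridLaplacianTranspose ψ z + c * ψ z) :=
      (continuous_hybridLaplacianTranspose ψ.contDiff).add (continuous_const.mul ψ.continuous)
    have h := integral_add (integrable_pairing u hψ) (integrable_pairing v hψ)
    simp only [ContinuousMap.add_apply, add_mul]
    rw [h, hu' ψ, hv' ψ, add_zero]
  smul_mem' := by
    rintro a u ⟨hu, hu'⟩
    refine ⟨fun z hz => by simp [hu z hz], fun ψ => ?_⟩
    simp only [ContinuousMap.smul_apply, smul_eq_mul, mul_assoc]
    rw [integral_const_mul, hu' ψ, mul_zero]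

/-- `c` is an eigenvalue of `-Δ̃` under Dirichlet boundary conditions. -/
def IsDirichletEigenvalue (c : ℂ) : Prop := ∃ u ∈ dirichletKer c, u ≠ 0

end ScatteringDisk

end

noncomputable section

namespace ScatteringDisk

/-! ### Wirtinger calculus -/

/-! Write `core p q` for the derivative `∂^p ∂̄^q (1 - |z|²)^(p+q-1)`, so that the scattering
polynomial is a constant times `(1 - |z|²) * core p q`. Comparing coefficients gives `∂∂̄ ((1 -
|z|²) core) = -pq core` (`dZ_dZbar_one_sub_mul_core`). This one identity says two things: the
scattering polynomial is an eigenfunction of the hybrid laplacian, and `core p q` is an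
eigenfunction of its transpose, both with eigenvalue `-pq`.

Upper bound. If `core p q` is allowed as a test function, every `u` in `ker (Δ̃ + c)` satisfies `(c
- pq) ∫ u core = 0`. It has no compact support, so it is cut off at distance of order `ε` from the
circle. The error is `O(1/ε)` on a layer of area `O(ε)`, where `u` is small because it vanishes on
the circle (`integral_mul_core_of_mem_dirichletKer`). The functions `core p q` span all monomials
`z^a z̄^b`, so by Stone-Weierstrass only `u = 0` is orthogonal to all of them
(`eq_zero_of_integral_mul_core_eq_zero`). Hence `c` must be some `pq`, and `u` is determined by its
pairings with the `core p q` for which `pq = c`.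

Lower bound. The scattering polynomials with `pq = k` lie in the kernel by Green's formula, and they
are independent because rotations act on them by distinct characters
(`linearIndependent_scatteringMap`). Both bounds equal the number of divisors of `k`. -/

theorem dZ_mul {f g : ℂ → ℂ} {z : ℂ} (hf : DifferentiableAt ℝ f z) (hg : DifferentiableAt ℝ g z) :
    dZ (fun x => f x * g x) z = dZ f z * g z + f z * dZ g z := by
  simp only [dZ, fderiv_fun_mul hf hg, _root_.add_apply,
    _root_.smul_apply, smul_eq_mul]
  ring

theorem dZbar_mul {f g : ℂ → ℂ} {z : ℂ} (hf : DifferentiableAt ℝ f z)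
    (hg : DifferentiableAt ℝ g z) :
    dZbar (fun x => f x * g x) z = dZbar f z * g z + f z * dZbar g z := by
  simp only [dZbar, fderiv_fun_mul hf hg, _root_.add_apply,
    _root_.smul_apply, smul_eq_mul]
  ring

theorem dZ_add {f g : ℂ → ℂ} {z : ℂ} (hf : DifferentiableAt ℝ f z) (hg : DifferentiableAt ℝ g z) :
    dZ (fun x => f x + g x) z = dZ f z + dZ g z := by
  simp only [dZ, fderiv_fun_add hf hg, _root_.add_apply]
  ring

theorem dZ_id (z : ℂ) : dZ (fun x => x) z = 1 := by
  simp only [dZ, fderiv_fun_id, ContinuousLinearMap.id_apply, Complex.I_mul_I]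
  norm_num

theorem hasFDerivAt_fderiv_apply {f : ℂ → ℂ} (hf : ContDiff ℝ ∞ f) (z v : ℂ) :
    HasFDerivAt (fun x => fderiv ℝ f x v) ((fderiv ℝ (fderiv ℝ f) z).flip v) z := by
  have hd : Differentiable ℝ (fderiv ℝ f) :=
    (hf.fderiv_right (m := ∞) (by simp)).differentiable (by simp)
  exact (hd z).hasFDerivAt.clm_apply (hasFDerivAt_const v z) |>.congr_fderiv (by ext; simp)

theorem laplacian_eq_dZ_dZbar {f : ℂ → ℂ} (hf : ContDiff ℝ ∞ f) (z : ℂ) :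
    (Δ f) z = 4 * dZ (dZbar f) z := by
  have hsymm : fderiv ℝ (fderiv ℝ f) z 1 Complex.I = fderiv ℝ (fderiv ℝ f) z Complex.I 1 :=
    (hf.contDiffAt.isSymmSndFDerivAt (by simp; norm_cast)) 1 Complex.I
  have h1 := hasFDerivAt_fderiv_apply hf z
  have h2 : HasFDerivAt (dZbar f) ((2 : ℂ)⁻¹ • ((fderiv ℝ (fderiv ℝ f) z).flip 1 +
      Complex.I • (fderiv ℝ (fderiv ℝ f) z).flip Complex.I)) z := by
    have h := (((h1 1).add ((h1 Complex.I).const_mul Complex.I)).const_mul (2 : ℂ)⁻¹)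
    refine h.congr_of_eventuallyEq (Filter.Eventually.of_forall fun x => ?_)
    simp only [dZbar, Pi.add_apply]
    ring
  rw [InnerProductSpace.laplacian_eq_iteratedFDeriv_complexPlane]
  simp only [iteratedFDeriv_two_apply, dZ, h2.fderiv, _root_.smul_apply,
    _root_.add_apply, ContinuousLinearMap.flip_apply, smul_eq_mul,
    Matrix.cons_val_zero, Matrix.cons_val_one]
  rw [hsymm]
  linear_combination (fderiv ℝ (fderiv ℝ f) z Complex.I Complex.I) * Complex.I_sq

theorem hasFDerivAt_monomial (a b : ℕ) (z : ℂ) :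
    HasFDerivAt (fun x : ℂ => x ^ a * conj x ^ b)
      ((z ^ a * (b * conj z ^ (b - 1))) • (Complex.conjCLE : ℂ →L[ℝ] ℂ) +
        (conj z ^ b * (a * z ^ (a - 1))) • ContinuousLinearMap.id ℝ ℂ) z := by
  have h1 : HasFDerivAt (fun x : ℂ => x ^ a) ((a * z ^ (a - 1)) • ContinuousLinearMap.id ℝ ℂ) z := by
    simpa using (hasFDerivAt_id (𝕜 := ℝ) z).pow a
  have h2 : HasFDerivAt (fun x : ℂ => conj x ^ b)
      ((b * conj z ^ (b - 1)) • (Complex.conjCLE : ℂ →L[ℝ] ℂ)) z := by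
    simpa using (Complex.conjCLE.hasFDerivAt (x := z)).pow b
  have h := h1.fun_mul h2
  simp only [smul_smul] at h
  exact h

theorem hasFDerivAt_sum_monomial {ι : Type*} (s : Finset ι) (c : ι → ℂ) (α β : ι → ℕ) (z : ℂ) :
    HasFDerivAt (fun x : ℂ => ∑ j ∈ s, c j * (x ^ α j * conj x ^ β j))
      (∑ j ∈ s, c j • ((z ^ α j * (β j * conj z ^ (β j - 1))) • (Complex.conjCLE : ℂ →L[ℝ] ℂ) +
        (conj z ^ β j * (α j * z ^ (α j - 1))) • ContinuousLinearMap.id ℝ ℂ)) z :=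
  HasFDerivAt.fun_sum fun j _ => (hasFDerivAt_monomial (α j) (β j) z).const_mul (c j)

/-- The truncated exponent `α j - 1` is harmless, since its coefficient vanishes when `α j = 0`. The
index type is arbitrary so that a disjoint union of ranges can be used below. -/
theorem dZ_sum_monomial {ι : Type*} (s : Finset ι) (c : ι → ℂ) (α β : ι → ℕ) :
    dZ (fun x : ℂ => ∑ j ∈ s, c j * (x ^ α j * conj x ^ β j)) =
      fun x => ∑ j ∈ s, c j * α j * (x ^ (α j - 1) * conj x ^ β j) := by
  ext z
  rw [dZ, (hasFDerivAt_sum_monomial s c α β z).fderiv]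
  simp only [_root_.sum_apply, _root_.smul_apply,
    _root_.add_apply, smul_eq_mul, ContinuousLinearMap.id_apply,
    ContinuousLinearEquiv.coe_coe, Complex.conjCLE_apply, map_one, Complex.conj_I]
  rw [Finset.mul_sum, ← Finset.sum_sub_distrib, Finset.sum_div]
  refine Finset.sum_congr rfl fun j _ => ?_
  linear_combination (c j * (z ^ α j * (β j * conj z ^ (β j - 1))) / 2 -
    c j * (conj z ^ β j * (α j * z ^ (α j - 1))) / 2) * Complex.I_mul_I

theorem dZbar_sum_monomial {ι : Type*} (s : Finset ι) (c : ι → ℂ) (α β : ι → ℕ) :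
    dZbar (fun x : ℂ => ∑ j ∈ s, c j * (x ^ α j * conj x ^ β j)) =
      fun x => ∑ j ∈ s, c j * β j * (x ^ α j * conj x ^ (β j - 1)) := by
  ext z
  rw [dZbar, (hasFDerivAt_sum_monomial s c α β z).fderiv]
  simp only [_root_.sum_apply, _root_.smul_apply,
    _root_.add_apply, smul_eq_mul, ContinuousLinearMap.id_apply,
    ContinuousLinearEquiv.coe_coe, Complex.conjCLE_apply, map_one, Complex.conj_I]
  rw [Finset.mul_sum, ← Finset.sum_add_distrib, Finset.sum_div]
  refine Finset.sum_congr rfl fun j _ => ?_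
  linear_combination (-(c j * (z ^ α j * (β j * conj z ^ (β j - 1)))) / 2 +
    c j * (conj z ^ β j * (α j * z ^ (α j - 1))) / 2) * Complex.I_mul_I

theorem dZ_iterate_sum_monomial {ι : Type*} (s : Finset ι) (c : ι → ℂ) (α β : ι → ℕ) (p : ℕ) :
    dZ^[p] (fun x : ℂ => ∑ j ∈ s, c j * (x ^ α j * conj x ^ β j)) =
      fun x => ∑ j ∈ s, c j * (α j).descFactorial p * (x ^ (α j - p) * conj x ^ β j) := by
  induction p with
  | zero => simp
  | succ p ih =>
    rw [Function.iterate_succ_apply', ih,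
      dZ_sum_monomial s (fun j => c j * (α j).descFactorial p) (fun j => α j - p) β]
    funext x
    refine Finset.sum_congr rfl fun j _ => ?_
    rw [Nat.descFactorial_succ, Nat.sub_sub]
    push_cast
    ring

theorem dZbar_iterate_sum_monomial {ι : Type*} (s : Finset ι) (c : ι → ℂ) (α β : ι → ℕ) (q : ℕ) :
    dZbar^[q] (fun x : ℂ => ∑ j ∈ s, c j * (x ^ α j * conj x ^ β j)) =
      fun x => ∑ j ∈ s, c j * (β j).descFactorial q * (x ^ α j * conj x ^ (β j - q)) := by
  induction q with
  | zero => simp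
  | succ q ih =>
    rw [Function.iterate_succ_apply', ih,
      dZbar_sum_monomial s (fun j => c j * (β j).descFactorial q) α (fun j => β j - q)]
    funext x
    refine Finset.sum_congr rfl fun j _ => ?_
    rw [Nat.descFactorial_succ, Nat.sub_sub]
    push_cast
    ring

/-! ### The polynomial factor of a scattering polynomial -/

/-- The factor `∂^{p+q} / ∂ζ^p ∂ζ̄^q (1 - ζζ̄)^{p+q-1}` of the scattering polynomial. -/
def core (p q : ℕ) : ℂ → ℂ := dZ^[p] (dZbar^[q] fun ξ => (1 - ξ * conj ξ) ^ (p + q - 1))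

/-- The coefficient of `z ^ (j - p) * z̄ ^ (j - q)` in `core p q`. -/
def coreCoeff (p q j : ℕ) : ℂ :=
  (-1) ^ j * (p + q - 1).choose j * j.descFactorial q * j.descFactorial p

theorem core_eq_sum (p q : ℕ) :
    core p q = fun z => ∑ j ∈ Finset.range (p + q - 1 + 1),
      coreCoeff p q j * (z ^ (j - p) * conj z ^ (j - q)) := by
  have h : (fun ξ : ℂ => (1 - ξ * conj ξ) ^ (p + q - 1)) = fun ξ =>
      ∑ j ∈ Finset.range (p + q - 1 + 1),
        ((-1) ^ j * ((p + q - 1).choose j : ℂ)) * (ξ ^ j * conj ξ ^ j) := by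
    funext ξ
    rw [sub_eq_neg_add, add_pow]
    refine Finset.sum_congr rfl fun j _ => ?_
    rw [neg_pow, mul_pow]
    ring
  rw [core, h, dZbar_iterate_sum_monomial _ _ (fun j => j) (fun j => j)]
  rw [dZ_iterate_sum_monomial _
    (fun j => (-1) ^ j * ((p + q - 1).choose j : ℂ) * (j.descFactorial q : ℂ))
    (fun j => j) (fun j => j - q)]
  rfl

theorem contDiff_core (p q : ℕ) : ContDiff ℝ ∞ (core p q) := by
  have hc := contDiff_conj
  rw [core_eq_sum]
  fun_prop

theorem coreCoeff_eq_zero {p q j : ℕ} (h : ¬(p ≤ j ∧ q ≤ j)) : coreCoeff p q j = 0 := by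
  rw [not_and_or, not_le, not_le] at h
  rcases h with h | h <;> simp [coreCoeff, Nat.descFactorial_of_lt h]

theorem coreCoeff_succ (p q j : ℕ) (hj : j ≤ p + q - 1) :
    coreCoeff p q (j + 1) * (j + 1 - p : ℕ) * (j + 1 - q : ℕ) =
      -((p + q - 1 : ℕ) - j) * (j + 1) * coreCoeff p q j := by
  have h1 := congrArg (Nat.cast (R := ℂ)) (Nat.succ_descFactorial j p)
  have h2 := congrArg (Nat.cast (R := ℂ)) (Nat.succ_descFactorial j q)
  have h3 := congrArg (Nat.cast (R := ℂ)) (Nat.choose_succ_right_eq (p + q - 1) j)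
  rw [Nat.cast_mul, Nat.cast_mul] at h1 h2 h3
  rw [Nat.cast_sub hj] at h3
  simp only [Nat.cast_add, Nat.cast_one] at h1 h2 h3
  simp only [coreCoeff, pow_succ]
  have e : (-1 : ℂ) ^ j * -1 * ((p + q - 1).choose (j + 1) : ℂ) * ((j + 1).descFactorial q : ℂ) *
      ((j + 1).descFactorial p : ℂ) * ((j + 1 - p : ℕ) : ℂ) * ((j + 1 - q : ℕ) : ℂ) =
      -(-1 : ℂ) ^ j * ((p + q - 1).choose (j + 1) : ℂ) *
      (((j + 1 - q : ℕ) : ℂ) * ((j + 1).descFactorial q : ℂ)) *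
      (((j + 1 - p : ℕ) : ℂ) * ((j + 1).descFactorial p : ℂ)) := by ring
  rw [e, h1, h2]
  linear_combination (-(-1 : ℂ) ^ j * (j + 1) * (j.descFactorial q : ℂ) *
    (j.descFactorial p : ℂ)) * h3

/-- This is `∂∂̄ ((1 - |z|²) core) = -pq core` read off at `z^(j-p) z̄^(j-q)`. By `coreCoeff_succ`
it reduces to `(p + q - 1 - j)(j + 1) + (j + 1 - p)(j + 1 - q) = pq`. -/
theorem coreCoeff_recurrence {p q : ℕ} (hp : 1 ≤ p) {j : ℕ} (hj : j ≤ p + q - 1) :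
    coreCoeff p q (j + 1) * (j + 1 - p : ℕ) * (j + 1 - q : ℕ) -
      coreCoeff p q j * (j - p + 1 : ℕ) * (j - q + 1 : ℕ) = -(p * q) * coreCoeff p q j := by
  rw [coreCoeff_succ p q j hj]
  by_cases h : p ≤ j ∧ q ≤ j
  · obtain ⟨h1, h2⟩ := h
    rw [Nat.cast_sub (by omega : 1 ≤ p + q)]
    push_cast [Nat.cast_sub h1, Nat.cast_sub h2]
    ring
  · simp [coreCoeff_eq_zero h]

theorem coreCoeff_top_ne_zero {p q : ℕ} (hp : 1 ≤ p) (hq : 1 ≤ q) :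
    coreCoeff p q (p + q - 1) ≠ 0 := by
  have h1 : (p + q - 1).descFactorial q ≠ 0 := by
    rw [Ne, Nat.descFactorial_eq_zero_iff_lt]; omega
  have h2 : (p + q - 1).descFactorial p ≠ 0 := by
    rw [Ne, Nat.descFactorial_eq_zero_iff_lt]; omega
  simp [coreCoeff, h1, h2]

/-- The left copy of the range carries the terms from `1`, the right copy those from `-z z̄`; as a
single sum of monomials the product can be differentiated termwise. -/
theorem one_sub_mul_core (p q : ℕ) :
    (fun z => (1 - z * conj z) * core p q z) = fun z =>
      ∑ i ∈ (Finset.range (p + q - 1 + 1)).disjSum (Finset.range (p + q - 1 + 1)),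
        Sum.elim (coreCoeff p q) (fun j => -coreCoeff p q j) i *
          (z ^ (Sum.elim (fun j => j - p) (fun j => j - p + 1) i) *
            conj z ^ (Sum.elim (fun j => j - q) (fun j => j - q + 1) i)) := by
  funext z
  rw [Finset.sum_disjSum, core_eq_sum]
  simp only [Sum.elim_inl, Sum.elim_inr]
  rw [sub_mul, one_mul, sub_eq_add_neg, Finset.mul_sum, ← Finset.sum_neg_distrib]
  congr 1
  refine Finset.sum_congr rfl fun j _ => ?_
  ring

theorem dZ_dZbar_one_sub_mul_core {p q : ℕ} (hp : 1 ≤ p) (z : ℂ) :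
    dZ (dZbar fun z => (1 - z * conj z) * core p q z) z = -(p * q) * core p q z := by
  rw [one_sub_mul_core, dZbar_sum_monomial, dZ_sum_monomial _ _ _
    (fun i => Sum.elim (fun j => j - q) (fun j => j - q + 1) i - 1)]
  simp only [Finset.sum_disjSum, Sum.elim_inl, Sum.elim_inr, Nat.add_sub_cancel]
  -- Shifting `j` to `j + 1` aligns the two copies. The `j = 0` term drops out because `0 - q = 0`,
  -- and the new top coefficient is zero because its binomial coefficient is.
  have hshift : ∑ j ∈ Finset.range (p + q - 1 + 1), coreCoeff p q j * ((j - q : ℕ) : ℂ) *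
        ((j - p : ℕ) : ℂ) * (z ^ (j - p - 1) * conj z ^ (j - q - 1)) =
      ∑ j ∈ Finset.range (p + q - 1 + 1), coreCoeff p q (j + 1) * ((j + 1 - p : ℕ) : ℂ) *
        ((j + 1 - q : ℕ) : ℂ) * (z ^ (j - p) * conj z ^ (j - q)) := by
    rw [Finset.sum_range_succ', Finset.sum_range_succ _ (p + q - 1)]
    have h0 : coreCoeff p q (p + q - 1 + 1) = 0 := by
      simp [coreCoeff]
    simp only [h0, Nat.zero_sub, Nat.cast_zero, mul_zero, zero_mul, add_zero]
    refine Finset.sum_congr rfl fun j _ => ?_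
    rw [show j + 1 - p - 1 = j - p by omega, show j + 1 - q - 1 = j - q by omega]
    ring
  rw [hshift, core_eq_sum, ← Finset.sum_add_distrib, Finset.mul_sum]
  refine Finset.sum_congr rfl fun j hj => ?_
  linear_combination (z ^ (j - p) * conj z ^ (j - q)) *
    coreCoeff_recurrence hp (Nat.lt_succ_iff.mp (Finset.mem_range.mp hj))

theorem weight_eq (z : ℂ) : weight z = (1 - z * conj z) / 4 := by
  rw [weight, Complex.mul_conj, Complex.normSq_eq_norm_sq]
  push_cast
  ring

/-- The normalizing constant of the scattering polynomial. -/
def scatteringConst (p q : ℕ) : ℂ := (-1) ^ p / (q * (p + q - 1).factorial : ℂ)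

theorem scatteringConst_ne_zero (p : ℕ) {q : ℕ} (hq : 1 ≤ q) : scatteringConst p q ≠ 0 := by
  have : (q : ℂ) ≠ 0 := by exact_mod_cast (by omega : q ≠ 0)
  have h2 : ((p + q - 1).factorial : ℂ) ≠ 0 := by exact_mod_cast Nat.factorial_ne_zero _
  simp [scatteringConst, this, h2]

theorem scatteringPoly_eq {p q : ℕ} (hp : 1 ≤ p) (hq : 1 ≤ q) :
    scatteringPoly p q = scatteringConst p q • fun z => (1 - z * conj z) * core p q z := by
  funext z
  simp [scatteringPoly, hp, hq, core, scatteringConst, mul_assoc]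

theorem contDiff_one_sub_mul_core (p q : ℕ) :
    ContDiff ℝ ∞ (fun z => (1 - z * conj z) * core p q z) := by
  have h1 := contDiff_conj
  have h2 := contDiff_core p q
  fun_prop

theorem laplacian_scatteringPoly {p q : ℕ} (hp : 1 ≤ p) (hq : 1 ≤ q) (z : ℂ) :
    (Δ (scatteringPoly p q)) z = -(4 * p * q) * scatteringConst p q * core p q z := by
  rw [scatteringPoly_eq hp hq, InnerProductSpace.laplacian_smul _
    ((contDiff_one_sub_mul_core p q).contDiffAt.of_le (by norm_cast)),
    laplacian_eq_dZ_dZbar (contDiff_one_sub_mul_core p q), dZ_dZbar_one_sub_mul_core hp,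
    smul_eq_mul]
  ring

theorem neg_hybridLaplacian_scatteringPoly {p q : ℕ} (hp : 1 ≤ p) (hq : 1 ≤ q) (z : ℂ) :
    -hybridLaplacian (scatteringPoly p q) z = (p * q : ℂ) * scatteringPoly p q z := by
  rw [hybridLaplacian, laplacian_scatteringPoly hp hq, scatteringPoly_eq hp hq, weight_eq]
  simp only [Pi.smul_apply, smul_eq_mul]
  ring

/-! ### Completeness of the polynomial factors -/

instance : IsFiniteMeasure area := ⟨area_univ_lt_top⟩

/-- The top term of `core (b + 1) (a + 1)` is a nonzero multiple of `z^a z̄^b`, and its other terms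
have a smaller power of `z`, so the system is triangular in `a`. -/
theorem integral_mul_monomial_eq_zero (u : C(closedDisk, ℂ))
    (h : ∀ p q : ℕ, 1 ≤ p → 1 ≤ q → ∫ z : closedDisk, u z * core p q z ∂area = 0) (a b : ℕ) :
    ∫ z : closedDisk, u z * ((z : ℂ) ^ a * conj (z : ℂ) ^ b) ∂area = 0 := by
  induction a using Nat.strong_induction_on generalizing b with
  | _ a ih =>
    have hcont : ∀ m n : ℕ, Continuous fun z : ℂ => z ^ m * conj z ^ n := fun m n => by fun_prop
    have key := h (b + 1) (a + 1) (by omega) (by omega)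
    have hne := coreCoeff_top_ne_zero (p := b + 1) (q := a + 1) (by omega) (by omega)
    rw [core_eq_sum] at key
    simp only [Finset.mul_sum, mul_left_comm (u _) (coreCoeff _ _ _)] at key
    rw [integral_finsetSum _ fun j _ => (integrable_pairing u (hcont _ _)).const_mul _] at key
    simp only [integral_const_mul] at key
    rw [Finset.sum_range_succ, Finset.sum_eq_zero, zero_add] at key
    · rw [show b + 1 + (a + 1) - 1 - (b + 1) = a by omega,
        show b + 1 + (a + 1) - 1 - (a + 1) = b by omega] at key
      exact (mul_eq_zero.mp key).resolve_left hne
    · intro j hj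
      rw [Finset.mem_range] at hj
      by_cases hjp : j < b + 1
      · rw [coreCoeff_eq_zero (by omega), zero_mul]
      · rw [ih (j - (b + 1)) (by omega), mul_zero]

/-- The pairing of a continuous function on the closed disk with `u`, as a functional. -/
def pairing (u : C(closedDisk, ℂ)) : C(closedDisk, ℂ) →L[ℂ] ℂ :=
  LinearMap.mkContinuous
    { toFun := fun h => ∫ z : closedDisk, u z * h z ∂area
      map_add' := fun f g => by
        have hi : ∀ f : C(closedDisk, ℂ), Integrable (fun z => u z * f z) area := fun f =>
          (u * f).continuous.integrable_of_hasCompactSupport (HasCompactSupport.of_compactSpace _)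
        simp only [ContinuousMap.add_apply, mul_add]
        exact integral_add (hi f) (hi g)
      map_smul' := fun a f => by
        simp only [ContinuousMap.smul_apply, smul_eq_mul, mul_left_comm (u _) a, RingHom.id_apply]
        exact integral_const_mul _ _ }
    (‖u‖ * area.real Set.univ) fun h => by
      refine (norm_integral_le_of_norm_le_const (C := ‖u‖ * ‖h‖)
        (Filter.Eventually.of_forall fun z => ?_)).trans (le_of_eq (by ring))
      rw [norm_mul]
      exact mul_le_mul (u.norm_coe_le_norm z) (h.norm_coe_le_norm z) (norm_nonneg _)
        (norm_nonneg _)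

theorem pairing_apply (u h : C(closedDisk, ℂ)) :
    pairing u h = ∫ z : closedDisk, u z * h z ∂area := rfl

/-- Stone-Weierstrass: the star subalgebra generated by `z` is spanned by the monomials `z^a z̄^b`
and is dense, while the kernel of the pairing is closed. -/
theorem pairing_eq_zero (u : C(closedDisk, ℂ))
    (h : ∀ a b : ℕ, ∫ z : closedDisk, u z * ((z : ℂ) ^ a * conj (z : ℂ) ^ b) ∂area = 0)
    (v : C(closedDisk, ℂ)) : pairing u v = 0 := by
  have hdense : v ∈ ((polynomialFunctions closedDisk).starClosure.topologicalClosure :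
      StarSubalgebra ℂ C(closedDisk, ℂ)) := by
    rw [polynomialFunctions.starClosure_topologicalClosure]
    trivial
  have hsub : ((polynomialFunctions closedDisk).starClosure : Set C(closedDisk, ℂ)) ⊆
      {v | pairing u v = 0} := by
    intro x hx
    rw [polynomialFunctions.starClosure_eq_adjoin_X, SetLike.mem_coe,
      ← StarSubalgebra.mem_toSubalgebra, StarAlgebra.adjoin_toSubalgebra,
      ← Subalgebra.mem_toSubmodule, Algebra.adjoin_eq_span] at hx
    have hle : Submodule.span ℂ (Submonoid.closure
        ({Polynomial.toContinuousMapOnAlgHom closedDisk Polynomial.X} ∪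
          star {Polynomial.toContinuousMapOnAlgHom closedDisk Polynomial.X}) :
          Set C(closedDisk, ℂ)) ≤ LinearMap.ker (pairing u).toLinearMap := by
      rw [Submodule.span_le, Set.star_singleton, Set.singleton_union]
      intro y hy
      rw [SetLike.mem_coe, Submonoid.mem_closure_pair] at hy
      obtain ⟨a, b, rfl⟩ := hy
      rw [SetLike.mem_coe, LinearMap.mem_ker]
      rw [← h a b]
      simp [pairing_apply]
    exact hle hx
  have hclosed : IsClosed {v | pairing u v = 0} :=
    isClosed_eq (pairing u).continuous continuous_const
  exact closure_minimal hsub hclosed hdense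

theorem dense_interior_closedDisk : Dense {z : closedDisk | ‖(z : ℂ)‖ < 1} := by
  rw [Subtype.dense_iff]
  have h : Subtype.val '' {z : closedDisk | ‖(z : ℂ)‖ < 1} = ball (0 : ℂ) 1 := by
    ext z
    simp only [Set.mem_image, Set.mem_ofPred_eq, Subtype.exists, mem_closedBall_zero_iff,
      mem_ball_zero_iff, exists_and_left, exists_prop, exists_eq_right_right]
    exact ⟨fun h => h.1, fun h => ⟨h, h.le⟩⟩
  rw [h, closure_ball _ one_ne_zero]

theorem area_apply (s : Set closedDisk) : area s = volume (Subtype.val '' s) :=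
  (MeasurableEmbedding.subtype_coe measurableSet_closedBall).comap_apply volume s

instance : area.IsOpenPosMeasure where
  open_pos U hU hne := by
    obtain ⟨V, hV, rfl⟩ := isOpen_induced_iff.mp hU
    obtain ⟨z, hz, hzV⟩ := dense_interior_closedDisk.exists_mem_open hU hne
    have hsub : V ∩ ball 0 1 ⊆ Subtype.val '' (Subtype.val ⁻¹' V : Set closedDisk) := fun w hw =>
      ⟨⟨w, ball_subset_closedBall hw.2⟩, hw.1, rfl⟩
    rw [area_apply]
    have hpos : volume (V ∩ ball (0 : ℂ) 1) ≠ 0 :=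
      (hV.inter isOpen_ball).measure_ne_zero volume ⟨z, hzV, by simpa using hz⟩
    exact fun h => hpos (measure_mono_null hsub h)

theorem eq_zero_of_integral_mul_core_eq_zero {u : C(closedDisk, ℂ)}
    (h : ∀ p q : ℕ, 1 ≤ p → 1 ≤ q → ∫ z : closedDisk, u z * core p q z ∂area = 0) : u = 0 := by
  have h0 := pairing_eq_zero u (integral_mul_monomial_eq_zero u h) (star u)
  have h1 : ∫ z : closedDisk, ‖u z‖ ^ 2 ∂area = 0 := by
    have : ∀ z, u z * (star u) z = ((‖u z‖ ^ 2 : ℝ) : ℂ) := fun z => by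
      rw [ContinuousMap.star_apply, RCLike.star_def, Complex.mul_conj, Complex.normSq_eq_norm_sq]
    simp only [pairing_apply, this] at h0
    exact Complex.ofReal_eq_zero.mp (integral_ofReal.symm.trans h0)
  have hc : Continuous fun z => ‖u z‖ ^ 2 := by fun_prop
  rw [integral_eq_zero_iff_of_nonneg (fun z => by positivity)
    (hc.integrable_of_hasCompactSupport (HasCompactSupport.of_compactSpace _)),
    hc.ae_eq_iff_eq area continuous_zero] at h1
  ext z
  simpa using congrFun h1 z

/-! ### Scattering polynomials lie in the Dirichlet kernels -/

theorem contDiff_fderiv_apply {f : ℂ → ℂ} (hf : ContDiff ℝ ∞ f) (v : ℂ) :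
    ContDiff ℝ ∞ fun x => fderiv ℝ f x v := by
  have h : ContDiff ℝ ∞ (fderiv ℝ f) := hf.fderiv_right (by simp)
  fun_prop

theorem laplacian_eq_fderiv_fderiv {f : ℂ → ℂ} (hf : ContDiff ℝ ∞ f) (z : ℂ) :
    (Δ f) z = fderiv ℝ (fun x => fderiv ℝ f x 1) z 1 +
      fderiv ℝ (fun x => fderiv ℝ f x Complex.I) z Complex.I := by
  have h1 := hasFDerivAt_fderiv_apply hf z
  rw [InnerProductSpace.laplacian_eq_iteratedFDeriv_complexPlane, (h1 1).fderiv,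
    (h1 Complex.I).fderiv]
  simp [iteratedFDeriv_two_apply]

theorem integral_mul_fderiv_of_hasCompactSupport {f h : ℂ → ℂ} (hf : ContDiff ℝ ∞ f)
    (hh : ContDiff ℝ ∞ h) (hs : HasCompactSupport h) (v : ℂ) :
    ∫ x, f x * fderiv ℝ h x v = -∫ x, fderiv ℝ f x v * h x := by
  refine integral_mul_fderiv_eq_neg_fderiv_mul_of_integrable ?_ ?_ ?_
    (fun x _ => hf.differentiable (by simp) x) (fun x _ => hh.differentiable (by simp) x)
  · exact ((contDiff_fderiv_apply hf v).continuous.mul hh.continuous).integrable_of_hasCompactSupport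
      hs.mul_left
  · exact (hf.continuous.mul (contDiff_fderiv_apply hh v).continuous).integrable_of_hasCompactSupport
      (hs.fderiv_apply ℝ v).mul_left
  · exact (hf.continuous.mul hh.continuous).integrable_of_hasCompactSupport hs.mul_left

theorem integral_mul_laplacian {f h : ℂ → ℂ} (hf : ContDiff ℝ ∞ f)
    (hh : ContDiff ℝ ∞ h) (hs : HasCompactSupport h) :
    ∫ x, f x * (Δ h) x = ∫ x, (Δ f) x * h x := by
  have key : ∀ v : ℂ, ∫ x, f x * fderiv ℝ (fun y => fderiv ℝ h y v) x v =
      ∫ x, fderiv ℝ (fun y => fderiv ℝ f y v) x v * h x := fun v => by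
    rw [integral_mul_fderiv_of_hasCompactSupport hf (contDiff_fderiv_apply hh v)
      (hs.fderiv_apply ℝ v) v, integral_mul_fderiv_of_hasCompactSupport
      (contDiff_fderiv_apply hf v) hh hs v, neg_neg]
  have i1 : ∀ v : ℂ, Integrable fun x => f x * fderiv ℝ (fun y => fderiv ℝ h y v) x v := fun v =>
    (hf.continuous.mul (contDiff_fderiv_apply (contDiff_fderiv_apply hh v)
      v).continuous).integrable_of_hasCompactSupport
      ((hs.fderiv_apply ℝ v).fderiv_apply ℝ v).mul_left
  have i2 : ∀ v : ℂ, Integrable fun x => fderiv ℝ (fun y => fderiv ℝ f y v) x v * h x := fun v =>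
    ((contDiff_fderiv_apply (contDiff_fderiv_apply hf v) v).continuous.mul
      hh.continuous).integrable_of_hasCompactSupport hs.mul_left
  simp only [laplacian_eq_fderiv_fderiv hf, laplacian_eq_fderiv_fderiv hh, mul_add, add_mul]
  rw [integral_add (i1 _) (i1 _), integral_add (i2 _) (i2 _), key, key]

theorem support_laplacian_subset (f : ℂ → ℂ) : Function.support (Δ f) ⊆ tsupport f := by
  intro z hz
  by_contra hcon
  refine hz ?_
  have h : f =ᶠ[nhds z] fun _ => 0 := notMem_tsupport_iff_eventuallyEq.mp hcon
  rw [InnerProductSpace.laplacian_congr_nhds h |>.eq_of_nhds]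
  simp

/-- The polynomial is smooth on the whole plane and `weight * ψ` has compact support, so Green's
formula has no boundary term and moves `Δ` onto the polynomial. -/
theorem scatteringMap_mem_dirichletKer {p q : ℕ} (hp : 1 ≤ p) (hq : 1 ≤ q) :
    scatteringMap p q ∈ dirichletKer (p * q) := by
  refine ⟨fun z hz => ?_, fun ψ => ?_⟩
  · change scatteringPoly p q z = 0
    rw [scatteringPoly_eq hp hq]
    simp [Complex.mul_conj, Complex.normSq_eq_norm_sq, hz]
  · have hφ := contDiff_scatteringPoly p q
    have hh : ContDiff ℝ ∞ fun z => weight z * ψ z := contDiff_weight.mul ψ.contDiff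
    have hs : HasCompactSupport fun z => weight z * ψ z := ψ.hasCompactSupport.mul_left
    have hsub : tsupport (fun z => weight z * ψ z) ⊆ closedDisk :=
      (tsupport_mul_subset_right).trans (ψ.tsupport_subset.trans ball_subset_closedBall)
    have hzero : ∀ z, z ∉ closedDisk →
        scatteringPoly p q z * (hybridLaplacianTranspose ψ z + (p * q) * ψ z) = 0 := by
      intro z hz
      have h1 : (Δ fun z => weight z * ψ z) z = 0 := by
        by_contra hne
        exact hz (hsub (support_laplacian_subset _ hne))
      have h2 : ψ z = 0 := by
        by_contra hne
        exact hz (ball_subset_closedBall (ψ.tsupport_subset (subset_tsupport _ hne)))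
      rw [hybridLaplacianTranspose, h1, h2]
      simp
    have hint : ∫ z : closedDisk, scatteringMap p q z *
        (hybridLaplacianTranspose ψ z + (p * q) * ψ z) ∂area =
        ∫ z, scatteringPoly p q z * (hybridLaplacianTranspose ψ z + (p * q) * ψ z) := by
      rw [← setIntegral_eq_integral_of_forall_compl_eq_zero hzero,
        ← integral_subtype_comap measurableSet_closedBall]
      rfl
    rw [hint]
    have hψ : HasCompactSupport (ψ : ℂ → ℂ) := ψ.hasCompactSupport
    have i1 : Integrable fun z => scatteringPoly p q z * hybridLaplacianTranspose ψ z :=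
      (hφ.continuous.mul (continuous_hybridLaplacianTranspose
        ψ.contDiff)).integrable_of_hasCompactSupport
        (HasCompactSupport.mul_left (hs.mono' (support_laplacian_subset _)))
    have i2 : Integrable fun z => scatteringPoly p q z * ((p * q) * ψ z) :=
      (hφ.continuous.mul (continuous_const.mul ψ.continuous)).integrable_of_hasCompactSupport
        hψ.mul_left.mul_left
    simp only [mul_add]
    rw [integral_add i1 i2]
    simp only [hybridLaplacianTranspose]
    rw [integral_mul_laplacian hφ hh hs, add_comm, ← eq_neg_iff_add_eq_zero, ← integral_neg]
    congr 1
    funext z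
    have := neg_hybridLaplacian_scatteringPoly hp hq z
    rw [hybridLaplacian] at this
    linear_combination (-ψ z) * this

/-! ### Linear independence -/

/-- Every monomial `z^(j-p) z̄^(j-q)` that occurs has the same angular weight `(j - p) - (j - q) = q
- p`. -/
theorem core_mul_of_norm_eq_one {p q : ℕ} {a : ℂ} (ha : ‖a‖ = 1) (z : ℂ) :
    core p q (a * z) = a ^ ((q : ℤ) - p) * core p q z := by
  have ha0 : a ≠ 0 := by rintro rfl; simp at ha
  have hc : conj a = a⁻¹ := (Complex.inv_eq_conj ha).symm
  simp only [core_eq_sum, Finset.mul_sum]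
  refine Finset.sum_congr rfl fun j _ => ?_
  by_cases h : p ≤ j ∧ q ≤ j
  · have : a ^ (j - p) * (a⁻¹) ^ (j - q) = a ^ ((q : ℤ) - p) := by
      rw [← zpow_natCast, ← zpow_natCast, inv_zpow', ← zpow_add₀ ha0]
      congr 1
      omega
    rw [← this, map_mul, hc, mul_pow, mul_pow]
    ring
  · simp [coreCoeff_eq_zero h]

/-- Restricted to the radius `(0, 1)`, `core p q` is a polynomial in `r` whose coefficient at
`r^(p+q-2)` comes from the top index `j = p + q - 1` alone. -/
theorem exists_core_ne_zero {p q : ℕ} (hp : 1 ≤ p) (hq : 1 ≤ q) :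
    ∃ z : ℂ, ‖z‖ < 1 ∧ core p q z ≠ 0 := by
  by_contra! hcon
  let P : Polynomial ℂ := ∑ j ∈ Finset.range (p + q - 1 + 1),
    Polynomial.C (coreCoeff p q j) * Polynomial.X ^ ((j - p) + (j - q))
  have hroot : ∀ r ∈ Set.Ioo (0 : ℝ) 1, P.IsRoot (r : ℂ) := by
    intro r hr
    have h := hcon r (by rw [Complex.norm_real, Real.norm_eq_abs, abs_of_pos hr.1]; exact hr.2)
    rw [core_eq_sum] at h
    simpa [P, Polynomial.eval_finsetSum, pow_add] using h
  have hP : P = 0 := by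
    refine Polynomial.eq_zero_of_infinite_isRoot P (Set.Infinite.mono ?_
      ((Set.Ioo_infinite (zero_lt_one (α := ℝ))).image Complex.ofReal_injective.injOn))
    rintro _ ⟨r, hr, rfl⟩
    exact hroot r hr
  have hcoeff := congrArg (fun Q => Polynomial.coeff Q (p + q - 2)) hP
  simp only [P, Polynomial.finsetSum_coeff, Polynomial.coeff_C_mul, Polynomial.coeff_X_pow,
    Polynomial.coeff_zero] at hcoeff
  rw [Finset.sum_range_succ, Finset.sum_eq_zero, zero_add,
    if_pos (by omega : p + q - 2 = p + q - 1 - p + (p + q - 1 - q)), mul_one] at hcoeff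
  · exact coreCoeff_top_ne_zero hp hq hcoeff
  · intro j hj
    rw [Finset.mem_range] at hj
    by_cases h : p ≤ j ∧ q ≤ j
    · rw [if_neg (by omega), mul_zero]
    · simp [coreCoeff_eq_zero h]

theorem scatteringMap_ne_zero {p q : ℕ} (hp : 1 ≤ p) (hq : 1 ≤ q) : scatteringMap p q ≠ 0 := by
  obtain ⟨z, hz, hne⟩ := exists_core_ne_zero hp hq
  intro h
  have h1 : scatteringPoly p q z = 0 :=
    DFunLike.congr_fun h (⟨z, mem_closedBall_zero_iff.mpr hz.le⟩ : closedDisk)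
  rw [scatteringPoly_eq hp hq] at h1
  have h2 : 1 - z * conj z ≠ 0 := by
    rw [Complex.mul_conj, Complex.normSq_eq_norm_sq]
    norm_cast
    nlinarith [norm_nonneg z]
  simp [scatteringConst_ne_zero p hq, h2, hne] at h1

/-- Rotation of the closed disk by a unimodular number. -/
def rotation (a : ℂ) (ha : ‖a‖ = 1) : C(closedDisk, closedDisk) where
  toFun z := ⟨a * z, mem_closedBall_zero_iff.mpr <| by
    rw [norm_mul, ha, one_mul]; exact mem_closedBall_zero_iff.mp z.2⟩
  continuous_toFun := by fun_prop

theorem scatteringMap_hasEigenvector {p q : ℕ} (hp : 1 ≤ p) (hq : 1 ≤ q) {a : ℂ} (ha : ‖a‖ = 1) :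
    Module.End.HasEigenvector
      (ContinuousMap.compRightAlgHom ℂ ℂ (rotation a ha)).toLinearMap (a ^ ((q : ℤ) - p))
      (scatteringMap p q) := by
  refine ⟨Module.End.mem_eigenspace_iff.mpr ?_, scatteringMap_ne_zero hp hq⟩
  ext z
  change scatteringPoly p q (a * z) = a ^ ((q : ℤ) - p) * scatteringPoly p q z
  have h : a * conj a = 1 := by simp [Complex.mul_conj, Complex.normSq_eq_norm_sq, ha]
  rw [scatteringPoly_eq hp hq]
  simp only [Pi.smul_apply, smul_eq_mul, core_mul_of_norm_eq_one ha, map_mul]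
  linear_combination (-scatteringConst p q * a ^ ((q : ℤ) - p) * core p q z * z * conj (z : ℂ)) * h

theorem linearIndependent_scatteringMap (k : ℕ) :
    LinearIndependent ℂ fun q : k.divisors => scatteringMap (k / q) q := by
  -- For divisors of `k` the exponents `q - k / q` lie strictly between `-k` and `k`, so two of them
  -- that agree modulo `2k + 1` are equal.
  have hN : 2 * k + 1 ≠ 0 := by omega
  have hprim := Complex.isPrimitiveRoot_exp (2 * k + 1) hN
  set a := Complex.exp (2 * Real.pi * Complex.I / (2 * k + 1 : ℕ)) with ha_def
  have ha : ‖a‖ = 1 := hprim.norm'_eq_one hN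
  have ha0 : a ≠ 0 := by intro h; simp [h] at ha
  have hdiv : ∀ q : k.divisors, 1 ≤ k / (q : ℕ) ∧ 1 ≤ (q : ℕ) ∧ k / (q : ℕ) * q = k := fun q => by
    have hq := Nat.mem_divisors.mp q.2
    have h := Nat.div_mul_cancel hq.1
    refine ⟨Nat.pos_of_ne_zero fun h0 => hq.2 ?_, Nat.pos_of_ne_zero fun h0 => hq.2 ?_, h⟩
    · rw [← h, h0, zero_mul]
    · rw [← h, h0, mul_zero]
  refine Module.End.eigenvectors_linearIndependent'
    (ContinuousMap.compRightAlgHom ℂ ℂ (rotation a ha)).toLinearMap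
    (fun q : k.divisors => a ^ (((q : ℕ) : ℤ) - (k / (q : ℕ) : ℕ))) ?_ _
    fun q => scatteringMap_hasEigenvector (hdiv q).1 (hdiv q).2.1 ha
  intro q r hqr
  dsimp only at hqr
  obtain ⟨h1, h2, h3⟩ := hdiv q
  obtain ⟨h4, h5, h6⟩ := hdiv r
  generalize k / (q : ℕ) = s at *
  generalize k / (r : ℕ) = t at *
  have hdvd : ((2 * k + 1 : ℕ) : ℤ) ∣ ((q : ℕ) : ℤ) - s - (((r : ℕ) : ℤ) - t) := by
    rw [← hprim.zpow_eq_one_iff_dvd, zpow_sub₀ ha0, div_eq_one_iff_eq (zpow_ne_zero _ ha0)]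
    exact hqr
  have b1 : (q : ℕ) ≤ k := Nat.divisor_le q.2
  have b2 : (r : ℕ) ≤ k := Nat.divisor_le r.2
  have b3 : s ≤ k := by nlinarith
  have b4 : t ≤ k := by nlinarith
  have hzero := Int.eq_zero_of_abs_lt_dvd hdvd (by rw [abs_lt]; constructor <;> push_cast <;> omega)
  apply Subtype.ext
  -- Equal differences `q - s = r - t` with `q < r` would force `s < t`, contradicting `s * q = t *
  -- r`.
  rcases lt_trichotomy (q : ℕ) (r : ℕ) with hlt | heq | hlt
  · have : s < t := by omega
    nlinarith
  · exact heq
  · have : t < s := by omega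
    nlinarith

/-! ### Testing against functions that do not vanish near the boundary -/

/-- A smooth function on the line that is `0` up to `1` and `1` from `2` on. -/
def step (t : ℝ) : ℝ := Real.smoothTransition (t - 1)

theorem contDiff_step : ContDiff ℝ ∞ step :=
  Real.smoothTransition.contDiff.comp (contDiff_id.sub contDiff_const)

theorem contDiff_deriv_step : ContDiff ℝ ∞ (deriv step) :=
  (contDiff_infty_iff_deriv.mp contDiff_step).2

theorem contDiff_deriv_deriv_step : ContDiff ℝ ∞ (deriv (deriv step)) :=
  (contDiff_infty_iff_deriv.mp contDiff_deriv_step).2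

theorem step_of_le {t : ℝ} (ht : t ≤ 1) : step t = 0 :=
  Real.smoothTransition.zero_of_nonpos (by linarith)

theorem step_of_ge {t : ℝ} (ht : 2 ≤ t) : step t = 1 :=
  Real.smoothTransition.one_of_one_le (by linarith)

theorem deriv_step_eq_zero {t : ℝ} (ht : t ∉ Set.Icc (1 : ℝ) 2) : deriv step t = 0 := by
  rw [Set.mem_Icc, not_and_or, not_le, not_le] at ht
  rcases ht with ht | ht
  · have h : step =ᶠ[nhds t] fun _ => 0 :=
      (eventually_lt_nhds ht).mono fun s hs => step_of_le hs.le
    rw [h.deriv_eq, deriv_const]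
  · have h : step =ᶠ[nhds t] fun _ => 1 :=
      (eventually_gt_nhds ht).mono fun s hs => step_of_ge hs.le
    rw [h.deriv_eq, deriv_const]

theorem deriv_deriv_step_eq_zero {t : ℝ} (ht : t ∉ Set.Icc (1 : ℝ) 2) :
    deriv (deriv step) t = 0 := by
  have h : deriv step =ᶠ[nhds t] fun _ => 0 :=
    (isClosed_Icc.isOpen_compl.eventually_mem ht).mono fun s hs => deriv_step_eq_zero hs
  rw [h.deriv_eq, deriv_const]

theorem exists_bound_deriv_step :
    ∃ K : ℝ, 0 ≤ K ∧ ∀ t, |deriv step t| ≤ K ∧ |deriv (deriv step) t| ≤ K := by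
  obtain ⟨K₁, h₁⟩ := (isCompact_Icc (a := (1 : ℝ)) (b := 2)).exists_bound_of_continuousOn
    contDiff_deriv_step.continuous.continuousOn
  obtain ⟨K₂, h₂⟩ := (isCompact_Icc (a := (1 : ℝ)) (b := 2)).exists_bound_of_continuousOn
    contDiff_deriv_deriv_step.continuous.continuousOn
  refine ⟨max (max K₁ K₂) 0, le_max_right _ _, fun t => ?_⟩
  by_cases ht : t ∈ Set.Icc (1 : ℝ) 2
  · exact ⟨(h₁ t ht).trans ((le_max_left _ _).trans (le_max_left _ _)),
      (h₂ t ht).trans ((le_max_right _ _).trans (le_max_left _ _))⟩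
  · rw [deriv_step_eq_zero ht, deriv_deriv_step_eq_zero ht]
    simp

theorem fderiv_radial {h : ℝ → ℝ} (hh : Differentiable ℝ h) (ε : ℝ) (z v : ℂ) :
    fderiv ℝ (fun x : ℂ => ((h ((1 - ‖x‖ ^ 2) / ε) : ℝ) : ℂ)) z v =
      ((deriv h ((1 - ‖z‖ ^ 2) / ε) * (-(2 * (z.re * v.re + z.im * v.im)) / ε) : ℝ) : ℂ) := by
  have h1 : HasFDerivAt (fun x : ℂ => (1 - ‖x‖ ^ 2) * ε⁻¹)
      (ε⁻¹ • (-(2 • innerSL ℝ z) : ℂ →L[ℝ] ℝ)) z :=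
    ((hasStrictFDerivAt_norm_sq z).hasFDerivAt.const_sub 1).mul_const ε⁻¹
  have h2 := Complex.ofRealCLM.hasFDerivAt.comp z
    ((hh ((1 - ‖z‖ ^ 2) * ε⁻¹)).hasDerivAt.comp_hasFDerivAt z h1)
  have h3 : HasFDerivAt (fun x : ℂ => ((h ((1 - ‖x‖ ^ 2) / ε) : ℝ) : ℂ)) _ z := h2
  rw [h3.fderiv]
  simp [Complex.inner, div_eq_mul_inv]
  ring

theorem dZ_radial {h : ℝ → ℝ} (hh : Differentiable ℝ h) (ε : ℝ) (z : ℂ) :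
    dZ (fun x : ℂ => ((h ((1 - ‖x‖ ^ 2) / ε) : ℝ) : ℂ)) z =
      -(deriv h ((1 - ‖z‖ ^ 2) / ε) : ℝ) * conj z / ε := by
  rw [dZ, fderiv_radial hh, fderiv_radial hh]
  apply Complex.ext <;> simp <;> ring

theorem dZbar_radial {h : ℝ → ℝ} (hh : Differentiable ℝ h) (ε : ℝ) (z : ℂ) :
    dZbar (fun x : ℂ => ((h ((1 - ‖x‖ ^ 2) / ε) : ℝ) : ℂ)) z =
      -(deriv h ((1 - ‖z‖ ^ 2) / ε) : ℝ) * z / ε := by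
  rw [dZbar, fderiv_radial hh, fderiv_radial hh]
  apply Complex.ext <;> simp <;> ring

/-- The radial cutoff that vanishes where `1 - |z|² ≤ ε` and equals `1` where `1 - |z|² ≥ 2ε`. -/
def cutoff (ε : ℝ) (z : ℂ) : ℂ := ((step ((1 - ‖z‖ ^ 2) / ε) : ℝ) : ℂ)

theorem contDiff_radial {h : ℝ → ℝ} (hh : ContDiff ℝ ∞ h) (ε : ℝ) :
    ContDiff ℝ ∞ fun x : ℂ => ((h ((1 - ‖x‖ ^ 2) / ε) : ℝ) : ℂ) := by
  have h1 : ContDiff ℝ ∞ (fun z : ℂ => ‖z‖ ^ 2) := contDiff_norm_sq ℝ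
  exact Complex.ofRealCLM.contDiff.comp (hh.comp ((contDiff_const.sub h1).div_const ε))

theorem dZ_dZbar_cutoff (ε : ℝ) (z : ℂ) :
    dZ (dZbar (cutoff ε)) z = (deriv (deriv step) ((1 - ‖z‖ ^ 2) / ε) : ℝ) * (conj z * z) / ε ^ 2 -
      (deriv step ((1 - ‖z‖ ^ 2) / ε) : ℝ) / ε := by
  have hd : Differentiable ℝ (deriv step) := contDiff_deriv_step.differentiable (by simp)
  have h1 : dZbar (cutoff ε) = fun x =>
      ((deriv step ((1 - ‖x‖ ^ 2) / ε) : ℝ) : ℂ) * ((fun x => x) x * (fun _ => -1 / (ε : ℂ)) x) := by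
    funext x
    unfold cutoff
    rw [dZbar_radial (contDiff_step.differentiable (by simp))]
    ring
  have hc : dZ (fun _ => -1 / (ε : ℂ)) z = 0 := by simp [dZ]
  rw [h1, dZ_mul ((contDiff_radial contDiff_deriv_step ε).differentiable (by simp) z)
    (by fun_prop), dZ_mul (by fun_prop) (by fun_prop), dZ_radial hd, dZ_id, hc]
  ring

/-- The terms of `∂∂̄ (χ f)` that involve a derivative of the cutoff `χ`. -/
def cutoffError (ε : ℝ) (f : ℂ → ℂ) (z : ℂ) : ℂ :=
  dZ (dZbar (cutoff ε)) z * f z + dZbar (cutoff ε) z * dZ f z + dZ (cutoff ε) z * dZbar f z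

theorem dZ_dZbar_cutoff_mul (ε : ℝ) {f : ℂ → ℂ} (hf : ContDiff ℝ ∞ f) (z : ℂ) :
    dZ (dZbar fun x => cutoff ε x * f x) z =
      cutoff ε z * dZ (dZbar f) z + cutoffError ε f z := by
  have hχ : ContDiff ℝ ∞ (cutoff ε) := contDiff_radial contDiff_step ε
  have d : ∀ {g : ℂ → ℂ}, ContDiff ℝ ∞ g → ∀ x, DifferentiableAt ℝ g x := fun hg x =>
    hg.differentiable (by simp) x
  have h1 : (dZbar fun x => cutoff ε x * f x) =
      fun x => dZbar (cutoff ε) x * f x + cutoff ε x * dZbar f x := by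
    funext x
    exact dZbar_mul (d hχ x) (d hf x)
  rw [h1, dZ_add ((d (contDiff_dZbar hχ) z).fun_mul (d hf z))
    ((d hχ z).fun_mul (d (contDiff_dZbar hf) z)), dZ_mul (d (contDiff_dZbar hχ) z) (d hf z),
    dZ_mul (d hχ z) (d (contDiff_dZbar hf) z), cutoffError]
  ring

theorem cutoffError_eq_zero {ε : ℝ} (f : ℂ → ℂ) {z : ℂ}
    (hz : (1 - ‖z‖ ^ 2) / ε ∉ Set.Icc (1 : ℝ) 2) : cutoffError ε f z = 0 := by
  have hd : Differentiable ℝ step := contDiff_step.differentiable (by simp)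
  have h1 : dZ (cutoff ε) z = 0 := by
    unfold cutoff
    rw [dZ_radial hd, deriv_step_eq_zero hz]; simp
  have h2 : dZbar (cutoff ε) z = 0 := by
    unfold cutoff
    rw [dZbar_radial hd, deriv_step_eq_zero hz]; simp
  rw [cutoffError, dZ_dZbar_cutoff, h1, h2, deriv_step_eq_zero hz, deriv_deriv_step_eq_zero hz]
  simp

/-- Second derivatives of the cutoff are of order `ε⁻²`, but they multiply only the undifferentiated
function, whose factor `1 - |z|²` is at most `2ε` on the layer. Every term is therefore of order
`ε⁻¹`. -/
theorem exists_bound_cutoffError {g : ℂ → ℂ} (hg : ContDiff ℝ ∞ g) :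
    ∃ C : ℝ, 0 ≤ C ∧ ∀ ε : ℝ, 0 < ε → ε ≤ 1 → ∀ z ∈ closedDisk,
      ‖cutoffError ε (fun x => (1 - x * conj x) * g x) z‖ ≤ C / ε := by
  have hf : ContDiff ℝ ∞ fun x : ℂ => (1 - x * conj x) * g x := by
    have := contDiff_conj
    fun_prop
  obtain ⟨K, hK, hbound⟩ := exists_bound_deriv_step
  have hcomp : IsCompact closedDisk := isCompact_closedBall 0 1
  obtain ⟨M₀, hM₀⟩ := hcomp.exists_bound_of_continuousOn hg.continuous.continuousOn
  obtain ⟨M₁, hM₁⟩ := hcomp.exists_bound_of_continuousOn (contDiff_dZ hf).continuous.continuousOn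
  obtain ⟨M₂, hM₂⟩ := hcomp.exists_bound_of_continuousOn
    (contDiff_dZbar hf).continuous.continuousOn
  have hzero : (0 : ℂ) ∈ closedDisk := by simp
  have p0 : 0 ≤ M₀ := (norm_nonneg _).trans (hM₀ 0 hzero)
  have p1 : 0 ≤ M₁ := (norm_nonneg _).trans (hM₁ 0 hzero)
  have p2 : 0 ≤ M₂ := (norm_nonneg _).trans (hM₂ 0 hzero)
  refine ⟨K * (4 * M₀ + M₁ + M₂), by positivity, fun ε hε hε1 z hz => ?_⟩
  by_cases ht : (1 - ‖z‖ ^ 2) / ε ∈ Set.Icc (1 : ℝ) 2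
  · have hz1 : ‖z‖ ≤ 1 := mem_closedBall_zero_iff.mp hz
    obtain ⟨b1, b2⟩ := hbound ((1 - ‖z‖ ^ 2) / ε)
    have hd : Differentiable ℝ step := contDiff_step.differentiable (by simp)
    have e1 : ‖dZ (cutoff ε) z‖ ≤ K / ε := by
      unfold cutoff
      rw [dZ_radial hd, norm_div, norm_mul, norm_neg, Complex.norm_real, Complex.norm_real,
        RCLike.norm_conj, Real.norm_of_nonneg hε.le, Real.norm_eq_abs]
      gcongr
      nlinarith [abs_nonneg (deriv step ((1 - ‖z‖ ^ 2) / ε)), norm_nonneg z]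
    have e2 : ‖dZbar (cutoff ε) z‖ ≤ K / ε := by
      unfold cutoff
      rw [dZbar_radial hd, norm_div, norm_mul, norm_neg, Complex.norm_real, Complex.norm_real,
        Real.norm_of_nonneg hε.le, Real.norm_eq_abs]
      gcongr
      nlinarith [abs_nonneg (deriv step ((1 - ‖z‖ ^ 2) / ε)), norm_nonneg z]
    have e3 : ‖dZ (dZbar (cutoff ε)) z‖ ≤ 2 * K / ε ^ 2 := by
      rw [dZ_dZbar_cutoff]
      refine (norm_sub_le _ _).trans ?_
      have t1 : ‖((deriv (deriv step) ((1 - ‖z‖ ^ 2) / ε) : ℝ) : ℂ) * (conj z * z) / (ε : ℂ) ^ 2‖ ≤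
          K / ε ^ 2 := by
        rw [norm_div, norm_mul, norm_mul, norm_pow, Complex.norm_real, Complex.norm_real,
          RCLike.norm_conj, Real.norm_of_nonneg hε.le, Real.norm_eq_abs]
        gcongr
        have : ‖z‖ * ‖z‖ ≤ 1 := by nlinarith [norm_nonneg z]
        nlinarith [abs_nonneg (deriv (deriv step) ((1 - ‖z‖ ^ 2) / ε))]
      have t2 : ‖((deriv step ((1 - ‖z‖ ^ 2) / ε) : ℝ) : ℂ) / (ε : ℂ)‖ ≤ K / ε ^ 2 := by
        rw [norm_div, Complex.norm_real, Complex.norm_real, Real.norm_of_nonneg hε.le,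
          Real.norm_eq_abs]
        gcongr
        nlinarith
      calc _ ≤ K / ε ^ 2 + K / ε ^ 2 := add_le_add t1 t2
        _ = 2 * K / ε ^ 2 := by ring
    have e4 : ‖(1 - z * conj z) * g z‖ ≤ 2 * ε * M₀ := by
      rw [norm_mul]
      have hw : ‖1 - z * conj z‖ ≤ 2 * ε := by
        rw [Complex.mul_conj, Complex.normSq_eq_norm_sq, ← Complex.ofReal_one,
          ← Complex.ofReal_sub, Complex.norm_real, Real.norm_of_nonneg
          (by nlinarith [norm_nonneg z])]
        exact (div_le_iff₀ hε).mp ht.2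
      exact mul_le_mul hw (hM₀ z hz) (norm_nonneg _) (by positivity)
    calc ‖cutoffError ε (fun x => (1 - x * conj x) * g x) z‖
        ≤ 2 * K / ε ^ 2 * (2 * ε * M₀) + K / ε * M₁ + K / ε * M₂ := by
          refine (norm_add₃_le).trans ?_
          simp only [norm_mul (dZ _ _), norm_mul (dZbar _ _)]
          gcongr
          · exact hM₁ z hz
          · exact hM₂ z hz
      _ = K * (4 * M₀ + M₁ + M₂) / ε := by field_simp; ring
  · rw [cutoffError_eq_zero _ ht, norm_zero]
    positivity

/-- The layer lies in the annulus `1 - 2ε ≤ |z|² ≤ 1 - ε`, whose area is exactly `πε`. -/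
theorem area_layer_le {ε : ℝ} (hε : 0 < ε) (hε1 : ε ≤ 1 / 2) :
    area.real {z : closedDisk | (1 - ‖(z : ℂ)‖ ^ 2) / ε ∈ Set.Icc (1 : ℝ) 2} ≤ Real.pi * ε := by
  have hsub : Subtype.val '' {z : closedDisk | (1 - ‖(z : ℂ)‖ ^ 2) / ε ∈ Set.Icc (1 : ℝ) 2} ⊆
      closedBall 0 (√(1 - ε)) \ ball (0 : ℂ) (√(1 - 2 * ε)) := by
    rintro _ ⟨z, ⟨h1, h2⟩, rfl⟩
    rw [le_div_iff₀ hε] at h1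
    rw [div_le_iff₀ hε] at h2
    constructor
    · rw [mem_closedBall_zero_iff]
      exact Real.le_sqrt_of_sq_le (by linarith)
    · rw [mem_ball_zero_iff, not_lt]
      exact (Real.sqrt_le_left (norm_nonneg _)).mpr (by linarith)
  have hle : √(1 - 2 * ε) ≤ √(1 - ε) := Real.sqrt_le_sqrt (by linarith)
  have hfin : volume (closedBall (0 : ℂ) (√(1 - ε)) \ ball (0 : ℂ) (√(1 - 2 * ε))) ≠ ⊤ :=
    measure_ne_top_of_subset Set.sdiff_subset measure_closedBall_lt_top.ne
  rw [Measure.real, area_apply]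
  refine (ENNReal.toReal_mono hfin (measure_mono hsub)).trans ?_
  rw [measure_sdiff (ball_subset_closedBall.trans (closedBall_subset_closedBall hle))
    measurableSet_ball.nullMeasurableSet measure_ball_lt_top.ne,
    ENNReal.toReal_sub_of_le (measure_mono (ball_subset_closedBall.trans
      (closedBall_subset_closedBall hle))) measure_closedBall_lt_top.ne,
    Complex.volume_closedBall, Complex.volume_ball]
  simp only [ENNReal.toReal_mul, ENNReal.toReal_pow, ENNReal.coe_toReal, NNReal.coe_real_pi]
  rw [ENNReal.toReal_ofReal (Real.sqrt_nonneg _), ENNReal.toReal_ofReal (Real.sqrt_nonneg _),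
    Real.sq_sqrt (by linarith), Real.sq_sqrt (by linarith)]
  exact le_of_eq (by ring)

/-- The test function obtained by cutting off a smooth function near the boundary. -/
def cutoffTest {ε : ℝ} (hε : 0 < ε) {g : ℂ → ℂ} (hg : ContDiff ℝ ∞ g) : 𝓓(disk, ℂ) :=
  have hsub : tsupport (fun z => cutoff ε z * g z) ⊆ {z : ℂ | ‖z‖ ^ 2 ≤ 1 - ε} := by
    refine closure_minimal (fun z hz => ?_) (isClosed_le (by fun_prop) continuous_const)
    by_contra hcon
    refine hz ?_
    have : (1 - ‖z‖ ^ 2) / ε ≤ 1 := by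
      rw [div_le_one hε]
      simp only [Set.mem_ofPred_eq, not_le] at hcon
      linarith
    simp [cutoff, step_of_le this]
  have hball : tsupport (fun z => cutoff ε z * g z) ⊆ ball 0 1 := fun z hz => by
    have h : ‖z‖ ^ 2 ≤ 1 - ε := hsub hz
    rw [mem_ball_zero_iff]
    nlinarith [norm_nonneg z]
  { toFun := fun z => cutoff ε z * g z
    contDiff' := (contDiff_radial contDiff_step ε).mul hg
    hasCompactSupport' := (isCompact_closedBall (0 : ℂ) 1).of_isClosed_subset
      (isClosed_tsupport _) (hball.trans ball_subset_closedBall)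
    tsupport_subset' := hball }

/-- The set where `‖u‖ ≥ δ` is compact and misses the circle, so `1 - |z|²` has a positive minimum
there. -/
theorem exists_small_near_boundary {u : C(closedDisk, ℂ)}
    (hu : ∀ z : closedDisk, ‖(z : ℂ)‖ = 1 → u z = 0) {δ : ℝ} (hδ : 0 < δ) :
    ∃ ε₀ > 0, ∀ z : closedDisk, 1 - ‖(z : ℂ)‖ ^ 2 < ε₀ → ‖u z‖ ≤ δ := by
  have hcl : IsCompact {z : closedDisk | δ ≤ ‖u z‖} :=
    (isClosed_le continuous_const (by fun_prop)).isCompact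
  rcases Set.eq_empty_or_nonempty {z : closedDisk | δ ≤ ‖u z‖} with he | hne
  · refine ⟨1, one_pos, fun z _ => ?_⟩
    by_contra hcon
    exact (Set.eq_empty_iff_forall_notMem.mp he z) (not_le.mp hcon).le
  · obtain ⟨w, hw, hmin⟩ := hcl.exists_isMinOn hne
      (f := fun z : closedDisk => 1 - ‖(z : ℂ)‖ ^ 2) (by fun_prop)
    have hw1 : ‖(w : ℂ)‖ ≤ 1 := mem_closedBall_zero_iff.mp w.2
    have hw2 : ‖(w : ℂ)‖ ≠ 1 := fun h => by
      have : δ ≤ ‖u w‖ := hw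
      rw [hu w h, norm_zero] at this
      linarith
    have hw3 : ‖(w : ℂ)‖ < 1 := lt_of_le_of_ne hw1 hw2
    refine ⟨1 - ‖(w : ℂ)‖ ^ 2, by nlinarith [norm_nonneg (w : ℂ)], fun z hz => ?_⟩
    by_contra hcon
    exact absurd (hmin (not_le.mp hcon).le) (not_le.mpr hz)

open Filter Topology in
-- Dominated convergence: at an interior point the cutoff is eventually `1`, and on the circle `u`
-- vanishes.
theorem tendsto_integral_cutoff (u : C(closedDisk, ℂ))
    (hu : ∀ z : closedDisk, ‖(z : ℂ)‖ = 1 → u z = 0) {G : ℂ → ℂ} (hG : Continuous G) :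
    Tendsto (fun ε : ℝ => ∫ z : closedDisk, u z * (cutoff ε z * G z) ∂area) (𝓝[>] 0)
      (𝓝 (∫ z : closedDisk, u z * G z ∂area)) := by
  refine tendsto_integral_filter_of_dominated_convergence (fun z => ‖u z * G z‖) ?_ ?_ ?_ ?_
  · refine Eventually.of_forall fun ε => ?_
    have h1 : Continuous (cutoff ε) := (contDiff_radial contDiff_step ε).continuous
    have : Continuous fun z : closedDisk => u z * (cutoff ε z * G z) := by fun_prop
    exact this.aestronglyMeasurable
  · refine Eventually.of_forall fun ε => Eventually.of_forall fun z => ?_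
    have h : ‖cutoff ε z‖ ≤ 1 := by
      rw [cutoff, step, Complex.norm_real, Real.norm_of_nonneg (Real.smoothTransition.nonneg _)]
      exact Real.smoothTransition.le_one _
    rw [norm_mul, norm_mul, norm_mul]
    gcongr
    exact mul_le_of_le_one_left (norm_nonneg _) h
  · exact (integrable_pairing u hG).norm
  · refine Eventually.of_forall fun z => ?_
    have hz : ‖(z : ℂ)‖ ≤ 1 := mem_closedBall_zero_iff.mp z.2
    rcases hz.eq_or_lt with h | h
    · simp [hu z h]
    · have hpos : 0 < 1 - ‖(z : ℂ)‖ ^ 2 := by nlinarith [norm_nonneg (z : ℂ)]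
      refine tendsto_const_nhds.congr' ?_
      have : ∀ᶠ ε in 𝓝[>] (0 : ℝ), ε < (1 - ‖(z : ℂ)‖ ^ 2) / 2 :=
        eventually_nhdsWithin_of_eventually_nhds (eventually_lt_nhds (by linarith))
      filter_upwards [this, self_mem_nhdsWithin] with ε hε hε0
      have hε0 : 0 < ε := hε0
      rw [cutoff, step_of_ge (by rw [le_div_iff₀ hε0]; linarith)]
      simp

open Filter Topology in
theorem tendsto_integral_cutoffError (u : C(closedDisk, ℂ))
    (hu : ∀ z : closedDisk, ‖(z : ℂ)‖ = 1 → u z = 0) {g : ℂ → ℂ} (hg : ContDiff ℝ ∞ g) :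
    Tendsto (fun ε : ℝ => ∫ z : closedDisk, u z *
      cutoffError ε (fun x => (1 - x * conj x) * g x) z ∂area) (𝓝[>] 0) (𝓝 0) := by
  obtain ⟨C, hC, hbound⟩ := exists_bound_cutoffError hg
  rw [Metric.tendsto_nhds]
  intro η hη
  have hden : 0 < C * Real.pi + 1 := by positivity
  -- On the layer the integral is at most `δ * (C / ε) * (π * ε) = δ * C * π`, uniformly in `ε`;
  -- this `δ` makes it at most `η / 2`, and the `+ 1` covers `C = 0`.
  obtain ⟨ε₀, hε₀, hsmall⟩ := exists_small_near_boundary hu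
    (show 0 < η / (2 * (C * Real.pi + 1)) by positivity)
  set δ := η / (2 * (C * Real.pi + 1)) with hδ
  -- The layer reaches up to `1 - |z|² = 2ε`, hence the bound `ε₀ / 2`.
  have ev1 : ∀ᶠ ε in 𝓝[>] (0 : ℝ), ε < ε₀ / 2 :=
    eventually_nhdsWithin_of_eventually_nhds (eventually_lt_nhds (by linarith))
  have ev2 : ∀ᶠ ε in 𝓝[>] (0 : ℝ), ε < 1 / 2 :=
    eventually_nhdsWithin_of_eventually_nhds (eventually_lt_nhds (by norm_num))
  filter_upwards [ev1, ev2, self_mem_nhdsWithin] with ε h1 h2 h3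
  have h3 : 0 < ε := h3
  rw [dist_zero_right]
  set S := {z : closedDisk | (1 - ‖(z : ℂ)‖ ^ 2) / ε ∈ Set.Icc (1 : ℝ) 2} with hS
  have hzero : ∀ z, z ∉ S → u z * cutoffError ε (fun x => (1 - x * conj x) * g x) z = 0 :=
    fun z hz => by rw [cutoffError_eq_zero _ hz, mul_zero]
  rw [← setIntegral_eq_integral_of_forall_compl_eq_zero hzero]
  have hle : ‖∫ z in S, u z * cutoffError ε (fun x => (1 - x * conj x) * g x) z ∂area‖ ≤
      δ * (C / ε) * area.real S := by
    refine norm_setIntegral_le_of_norm_le_const (measure_lt_top _ _) fun z hz => ?_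
    rw [norm_mul]
    have hz2 := (div_le_iff₀ h3).mp hz.2
    exact mul_le_mul (hsmall z (by linarith)) (hbound ε h3 (by linarith) z z.2) (norm_nonneg _)
      (by positivity)
  have harea : area.real S ≤ Real.pi * ε := area_layer_le h3 h2.le
  calc _ ≤ δ * (C / ε) * area.real S := hle
    _ ≤ δ * (C / ε) * (Real.pi * ε) := by gcongr
    _ = δ * (C * Real.pi) := by field_simp
    _ ≤ δ * (C * Real.pi + 1) := by gcongr; linarith
    _ = η / 2 := by rw [hδ]; field_simp
    _ < η := by linarith

open Filter Topology in
theorem integral_mul_core_of_mem_dirichletKer {c : ℂ} {u : C(closedDisk, ℂ)}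
    (hu : u ∈ dirichletKer c) {p q : ℕ} (hp : 1 ≤ p) :
    (c - p * q) * ∫ z : closedDisk, u z * core p q z ∂area = 0 := by
  obtain ⟨hbd, htest⟩ := hu
  have hcore := contDiff_core p q
  have hf := contDiff_one_sub_mul_core p q
  have key : ∀ ε : ℝ, 0 < ε →
      (c - p * q) * (∫ z : closedDisk, u z * (cutoff ε z * core p q z) ∂area) +
        ∫ z : closedDisk, u z *
          cutoffError ε (fun x => (1 - x * conj x) * core p q x) z ∂area = 0 := by
    intro ε hε
    have hχ : ContDiff ℝ ∞ (cutoff ε) := contDiff_radial contDiff_step ε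
    have h := htest (cutoffTest hε hcore)
    -- The product rule separates the main term, where both derivatives fall on `(1 - |z|²) core`
    -- and give `-pq core`, from the cutoff error.
    have htr : ∀ z, hybridLaplacianTranspose (cutoffTest hε hcore) z =
        cutoff ε z * (-(p * q) * core p q z) +
          cutoffError ε (fun x => (1 - x * conj x) * core p q x) z := by
      intro z
      have e : (fun z => weight z * cutoffTest hε hcore z) =
          (4 : ℂ)⁻¹ • fun z => cutoff ε z * ((1 - z * conj z) * core p q z) := by
        funext x
        change weight x * (cutoff ε x * core p q x) = _
        rw [weight_eq]
        simp only [Pi.smul_apply, smul_eq_mul]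
        ring
      rw [hybridLaplacianTranspose, e, InnerProductSpace.laplacian_smul _
        ((hχ.mul hf).contDiffAt.of_le (by norm_cast)), laplacian_eq_dZ_dZbar (hχ.mul hf),
        dZ_dZbar_cutoff_mul ε hf, dZ_dZbar_one_sub_mul_core hp, smul_eq_mul]
      ring
    have herr : Continuous (cutoffError ε (fun x => (1 - x * conj x) * core p q x)) := by
      have h1 := (contDiff_dZ (contDiff_dZbar hχ)).continuous
      have h2 := (contDiff_dZbar hχ).continuous
      have h3 := (contDiff_dZ hχ).continuous
      have h4 := (contDiff_dZ hf).continuous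
      have h5 := (contDiff_dZbar hf).continuous
      have h6 := hf.continuous
      unfold cutoffError
      fun_prop
    rw [← integral_const_mul, ← integral_add
      ((integrable_pairing u (hχ.continuous.fun_mul hcore.continuous)).const_mul _)
      (integrable_pairing u herr), ← h]
    congr 1
    funext z
    rw [htr]
    change _ = u z * (_ + c * (cutoff ε z * core p q z))
    ring
  have hlim := ((tendsto_integral_cutoff u hbd hcore.continuous).const_mul (c - p * q)).add
    (tendsto_integral_cutoffError u hbd hcore)
  rw [add_zero] at hlim
  refine tendsto_nhds_unique (hlim.congr' ?_) tendsto_const_nhds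
  filter_upwards [self_mem_nhdsWithin] with ε hε
  exact key ε hε

/-! ### The spectrum -/

theorem exists_eq_mul_of_isDirichletEigenvalue {c : ℂ} (h : IsDirichletEigenvalue c) :
    ∃ p q : ℕ, 1 ≤ p ∧ 1 ≤ q ∧ c = p * q := by
  obtain ⟨u, hu, hne⟩ := h
  by_contra! hcon
  exact hne (eq_zero_of_integral_mul_core_eq_zero fun p q hp hq =>
    (mul_eq_zero.mp (integral_mul_core_of_mem_dirichletKer hu hp)).resolve_left
      (sub_ne_zero.mpr (hcon p q hp hq)))

/-- The pairings of a member of `ker (Δ̃ + k)` with the polynomial factors of eigenvalue `k`. -/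
def coreCoordinates (k : ℕ) : dirichletKer (k : ℂ) →ₗ[ℂ] (k.divisors → ℂ) where
  toFun u q := ∫ z : closedDisk, (u : C(closedDisk, ℂ)) z * core (k / q) q z ∂area
  map_add' u v := by
    funext q
    have h : ∀ u : C(closedDisk, ℂ), Integrable (fun z => u z * core (k / q) q z) area := fun u =>
      integrable_pairing u (contDiff_core _ _).continuous
    simp only [Submodule.coe_add, ContinuousMap.add_apply, add_mul, Pi.add_apply]
    exact integral_add (h u) (h v)
  map_smul' a u := by
    funext q
    simp only [Submodule.coe_smul, ContinuousMap.smul_apply, smul_eq_mul, mul_assoc,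
      RingHom.id_apply, Pi.smul_apply]
    exact integral_const_mul _ _

/-- Pairings with `pq ≠ k` vanish automatically, and those with `pq = k` are the coordinates;
completeness then gives `u = 0`. -/
theorem coreCoordinates_injective (k : ℕ) (hk : 0 < k) :
    Function.Injective (coreCoordinates k) := by
  rw [injective_iff_map_eq_zero]
  intro u hu
  refine Subtype.ext (eq_zero_of_integral_mul_core_eq_zero fun p q hp hq => ?_)
  by_cases h : p * q = k
  · have hq' : q ∈ k.divisors := Nat.mem_divisors.mpr ⟨⟨p, by rw [← h, mul_comm]⟩, hk.ne'⟩
    have := congrFun hu ⟨q, hq'⟩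
    have hp' : k / q = p := by rw [← h, Nat.mul_div_cancel _ hq]
    simpa [coreCoordinates, hp'] using this
  · refine (mul_eq_zero.mp (integral_mul_core_of_mem_dirichletKer u.2 hp)).resolve_left ?_
    rw [sub_eq_zero]
    exact_mod_cast Ne.symm h

theorem setOf_scatteringMap_eq_range {k : ℕ} (hk : 0 < k) :
    {u | ∃ p q : ℕ, 1 ≤ p ∧ 1 ≤ q ∧ p * q = k ∧ u = scatteringMap p q} =
      Set.range fun q : k.divisors => scatteringMap (k / q) q := by
  ext u
  constructor
  · rintro ⟨p, q, hp, hq, h, rfl⟩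
    refine ⟨⟨q, Nat.mem_divisors.mpr ⟨⟨p, by rw [← h, mul_comm]⟩, hk.ne'⟩⟩, ?_⟩
    dsimp only
    rw [← h, Nat.mul_div_cancel _ hq]
  · rintro ⟨⟨q, hq⟩, rfl⟩
    have hd := Nat.dvd_of_mem_divisors hq
    have hq1 := Nat.pos_of_mem_divisors hq
    exact ⟨k / q, q, Nat.div_pos (Nat.le_of_dvd hk hd) hq1, hq1, Nat.div_mul_cancel hd, rfl⟩

theorem span_scatteringMap_le_dirichletKer (k : ℕ) :
    Submodule.span ℂ {u | ∃ p q : ℕ, 1 ≤ p ∧ 1 ≤ q ∧ p * q = k ∧ u = scatteringMap p q} ≤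
      dirichletKer k := by
  rw [Submodule.span_le]
  rintro _ ⟨p, q, hp, hq, rfl, rfl⟩
  rw [Nat.cast_mul]
  exact scatteringMap_mem_dirichletKer hp hq

theorem finrank_span_scatteringMap {k : ℕ} (hk : 0 < k) :
    Module.finrank ℂ (Submodule.span ℂ
      {u | ∃ p q : ℕ, 1 ≤ p ∧ 1 ≤ q ∧ p * q = k ∧ u = scatteringMap p q}) = k.divisors.card := by
  rw [setOf_scatteringMap_eq_range hk, finrank_span_eq_card (linearIndependent_scatteringMap k),
    Fintype.card_coe]

/-- Injectivity of `coreCoordinates` bounds the dimension of the kernel by the number of divisors,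
which the span inside it already attains. -/
theorem dirichletKer_eq_span {k : ℕ} (hk : 0 < k) :
    dirichletKer k = Submodule.span ℂ
      {u | ∃ p q : ℕ, 1 ≤ p ∧ 1 ≤ q ∧ p * q = k ∧ u = scatteringMap p q} := by
  have hfin : Module.Finite ℂ (dirichletKer (k : ℂ)) :=
    Module.Finite.of_injective _ (coreCoordinates_injective k hk)
  refine (Submodule.eq_of_le_of_finrank_le (span_scatteringMap_le_dirichletKer k) ?_).symm
  rw [finrank_span_scatteringMap hk]
  simpa using LinearMap.finrank_le_finrank_of_injective (coreCoordinates_injective k hk)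

end ScatteringDisk

end

theorem mainTheorem6 :
    (∀ c : ℂ, c ≠ 0 → ScatteringDisk.IsDirichletEigenvalue c → ∃ k : ℕ, 0 < k ∧ c = k) ∧
    (∀ p q : ℕ, 1 ≤ p → 1 ≤ q → ∀ z : ℂ,
      -ScatteringDisk.hybridLaplacian (ScatteringDisk.scatteringPoly p q) z = (p * q : ℂ) * ScatteringDisk.scatteringPoly p q z) ∧
    ∀ k : ℕ, 0 < k →
      ScatteringDisk.dirichletKer k =
        Submodule.span ℂ {u | ∃ p q : ℕ, 1 ≤ p ∧ 1 ≤ q ∧ p * q = k ∧ u = ScatteringDisk.scatteringMap p q} ∧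
      Module.finrank ℂ (ScatteringDisk.dirichletKer k) = k.divisors.card := by
  refine ⟨fun c _ h => ?_, fun p q hp hq z =>
    ScatteringDisk.neg_hybridLaplacian_scatteringPoly hp hq z, fun k hk =>
    ⟨ScatteringDisk.dirichletKer_eq_span hk, ?_⟩⟩
  · obtain ⟨p, q, hp, hq, rfl⟩ := ScatteringDisk.exists_eq_mul_of_isDirichletEigenvalue h
    exact ⟨p * q, Nat.mul_pos hp hq, by push_cast; rfl⟩
  · rw [ScatteringDisk.dirichletKer_eq_span hk, ScatteringDisk.finrank_span_scatteringMap hk]
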